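/- Conventions. A gauge is a non-decreasing, right-continuous function $\phi\colon[0,\infty)\to[0,\infty)$ with $\phi(0)=0$ and $\phi(r)>0$ for $r>0$. For a metric space $X$, $\mathscr H^\phi_X$ is the Hausdorff (outer) measure $\mathscr H^\phi_X(E)=\sup_{\delta>0}\inf\{\sum_n\phi(\operatorname{diam}E_n):\{E_n\}\text{ a countable cover of }E,\ \operatorname{diam}E_n<\delta\text{ for all }n\}$, and $\mathcal N(\mathscr H^\phi_X)=\{E\subseteq X:\mathscr H^\phi_X(E)=0\}$. For a sequence $s=\langle s_n:n\ge1\rangle$ of positive reals strictly decreasing to $0$, $\mathcal D_X(s^*)$ is the family of all $E\subseteq X$ such that for every integer $k\ge1$ there is a cover $\langle E_n:n\ge1\rangle$ of $E$ by subsets of $X$ with $\operatorname{diam}E_n<s_{kn}$ for all $n\ge1$. Write $\phi\asymp s$ if there are $a,b>0$ with $a\le n\,\phi(s_n)\le b$ for all but finitely many $n$. For $L>0$, $\phi$ is $L$-doubling if there is $R>0$ with $\phi(2r)\le L\phi(r)$ for all $r\in(0,R]$. Theorem. Let $s$ be a sequence of positive reals strictly decreasing to $0$ and let $\phi$ be a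 gauge with $\phi\asymp s$. Then: (i) $\mathcal N(\mathscr H^\phi_{\ell^2})\subsetneqq\mathcal D_{\ell^2}(s^*)\subsetneqq\bigcap_{\alpha>1}\mathcal N(\mathscr H^{\phi^\alpha}_{\ell^2})$, where $\ell^2$ is the real Hilbert space of square-summable sequences. (ii) If $\phi$ is $L$-doubling for some $0<L<2$, then $\mathcal N(\mathscr H^\phi_{\mathbb R})\subsetneqq\mathcal D_{\mathbb R}(s^*)\subsetneqq\bigcap_{\alpha>1}\mathcal N(\mathscr H^{\phi^\alpha}_{\mathbb R})$. -/

import Mathlib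

open Set Filter Topology
open scoped NNReal ENNReal

namespace DominatedSets

/-- A gauge: a non-decreasing, right-continuous function `φ : [0, ∞) → [0, ∞)` with `φ 0 = 0`
and `φ r > 0` for `r > 0`. -/
structure IsGauge (φ : ℝ≥0 → ℝ≥0) : Prop where
  mono : Monotone φ
  right_continuous : ∀ r, ContinuousWithinAt φ (Ici r) r
  map_zero : φ 0 = 0
  pos : ∀ r, 0 < r → 0 < φ r

/-- `φ` is `L`-doubling: `φ (2 r) ≤ L φ r` for all sufficiently small `r > 0`. -/
def IsDoublingWith (L : ℝ≥0) (φ : ℝ≥0 → ℝ≥0) : Prop :=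
  ∃ R : ℝ≥0, 0 < R ∧ ∀ r, 0 < r → r ≤ R → φ (2 * r) ≤ L * φ r

/-- The family of all strictly decreasing sequences of positive reals converging to `0`,
indexed by the positive integers. -/
def nullSequences : Set (ℕ+ → ℝ≥0) :=
  {s | StrictAnti s ∧ (∀ n, 0 < s n) ∧ Tendsto s atTop (𝓝 0)}

/-- The multiplicative `k`-shift `n ↦ s (k n)` of the sequence `s`. -/
def multShift (k : ℕ+) (s : ℕ+ → ℝ≥0) : ℕ+ → ℝ≥0 := fun n => s (k * n)

/-- The closure `s*` of a sequence: the set of all its multiplicative shifts. -/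
def multClosure (s : ℕ+ → ℝ≥0) : Set (ℕ+ → ℝ≥0) := {t | ∃ k : ℕ+, t = multShift k s}

/-- `φ ≍ s`: there are `a, b > 0` with `a ≤ n φ(s n) ≤ b` for all but finitely many `n`. -/
def Comparable (φ : ℝ≥0 → ℝ≥0) (s : ℕ+ → ℝ≥0) : Prop :=
  ∃ a b : ℝ≥0, 0 < a ∧ 0 < b ∧
    ∀ᶠ n : ℕ+ in atTop, a ≤ ((n : ℕ) : ℝ≥0) * φ (s n) ∧ ((n : ℕ) : ℝ≥0) * φ (s n) ≤ b

/-- A sequence of sets is `s`-fine if `diam (A n) < s n` for all `n`. The diameter takes values in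
`[0, ∞]`, so unbounded sets are never allowed. -/
def IsFine {X : Type*} [MetricSpace X] (s : ℕ+ → ℝ≥0) (A : ℕ+ → Set X) : Prop :=
  ∀ n, Metric.ediam (A n) < (s n : ℝ≥0∞)

/-- `D_X(S)`: the family of all `S`-dominated subsets of `X`, that is, of those `E` that have
an `s`-fine cover for each `s ∈ S`. -/
def dominatedSets (X : Type*) [MetricSpace X] (S : Set (ℕ+ → ℝ≥0)) : Set (Set X) :=
  {E | ∀ s ∈ S, ∃ A : ℕ+ → Set X, IsFine s A ∧ E ⊆ ⋃ n, A n}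

/-- The `φ`-dimensional Hausdorff (outer) measure `H^φ`. The value given to sets of infinite
diameter is immaterial, as only covers by sets of small diameter matter; see
`hausdorffGauge_apply` for the formula. -/
noncomputable def hausdorffGauge (X : Type*) [MetricSpace X] (φ : ℝ≥0 → ℝ≥0) :
    MeasureTheory.OuterMeasure X :=
  MeasureTheory.OuterMeasure.mkMetric fun d => (φ d.toNNReal : ℝ≥0∞)

/-- `H^φ(E)` is the supremum over `δ > 0` of the infima of `∑ φ(diam (A n))` over
all countable covers of `E` by sets of diameter less than `δ`. -/
theorem hausdorffGauge_apply {X : Type*} [MetricSpace X] {φ : ℝ≥0 → ℝ≥0} (hφ : IsGauge φ)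
    (E : Set X) :
    hausdorffGauge X φ E =
      ⨆ (δ : ℝ≥0) (_ : 0 < δ), ⨅ (A : ℕ → Set X) (_ : E ⊆ ⋃ n, A n)
        (_ : ∀ n, Metric.ediam (A n) < (δ : ℝ≥0∞)),
          ∑' n, (φ (Metric.ediam (A n)).toNNReal : ℝ≥0∞) := by
  let _ : MeasurableSpace X := borel X
  have _ : BorelSpace X := ⟨rfl⟩
  have key : ∀ A : Set X, (⨆ _ : A.Nonempty, (φ (Metric.ediam A).toNNReal : ℝ≥0∞)) =
      (φ (Metric.ediam A).toNNReal : ℝ≥0∞) := by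
    intro A
    rcases A.eq_empty_or_nonempty with rfl | h
    · simp [hφ.map_zero]
    · simp [h]
  rw [hausdorffGauge, MeasureTheory.OuterMeasure.coe_mkMetric,
    MeasureTheory.Measure.mkMetric_apply]
  simp only [key]
  apply le_antisymm
  · refine iSup₂_le fun r hr => ?_
    obtain ⟨δ, hδ, hδr⟩ := ENNReal.lt_iff_exists_nnreal_btwn.1 hr
    refine le_trans ?_ (le_iSup₂ (f := fun (δ : ℝ≥0) (_ : 0 < δ) =>
      ⨅ (A : ℕ → Set X) (_ : E ⊆ ⋃ n, A n) (_ : ∀ n, Metric.ediam (A n) < (δ : ℝ≥0∞)),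
          ∑' n, (φ (Metric.ediam (A n)).toNNReal : ℝ≥0∞)) δ (by exact_mod_cast hδ))
    exact le_iInf fun A => le_iInf fun hA => le_iInf fun hd =>
      iInf_le_of_le A (iInf_le_of_le hA
        (iInf_le_of_le (fun n => ((hd n).trans hδr).le) le_rfl))
  · refine iSup₂_le fun δ hδ => ?_
    have h2 : (0 : ℝ≥0∞) < ((δ / 2 : ℝ≥0) : ℝ≥0∞) := by exact_mod_cast half_pos hδ
    have h3 : ((δ / 2 : ℝ≥0) : ℝ≥0∞) < (δ : ℝ≥0∞) := by exact_mod_cast NNReal.half_lt_self hδ.ne'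
    refine le_trans ?_ (le_iSup₂ (f := fun (r : ℝ≥0∞) (_ : 0 < r) =>
      ⨅ (A : ℕ → Set X) (_ : E ⊆ ⋃ n, A n) (_ : ∀ n, Metric.ediam (A n) ≤ r),
          ∑' n, (φ (Metric.ediam (A n)).toNNReal : ℝ≥0∞)) _ h2)
    exact le_iInf fun A => le_iInf fun hA => le_iInf fun hd =>
      iInf_le_of_le A (iInf_le_of_le hA
        (iInf_le_of_le (fun n => (hd n).trans_lt h3) le_rfl))

/-- `N(H^φ)`: the family of all subsets of `X` of `φ`-dimensional Hausdorff measure zero. -/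
def nullSets (X : Type*) [MetricSpace X] (φ : ℝ≥0 → ℝ≥0) : Set (Set X) :=
  {E | hausdorffGauge X φ E = 0}

/-- The power `φ^α` of a gauge. -/
noncomputable def gaugePow (φ : ℝ≥0 → ℝ≥0) (α : ℝ) : ℝ≥0 → ℝ≥0 := fun r => φ r ^ α

/-- The real Hilbert space of square-summable sequences indexed by the positive integers. -/
abbrev EllTwo : Type := lp (fun _ : ℕ+ => ℝ) 2

end DominatedSets

namespace DominatedSets

/-! Since `φ (s n)` is of order `1 / n`, an `s`-fine cover behaves like a cover whose `n`-th set has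
gauge at most about `1 / n`. If the gauges of a cover have small sum, listing the sets by decreasing
gauge makes the `n`-th gauge at most the sum over `n`, hence the cover fine for a given shift
(`nullSets_subset_dominatedSets`). Conversely, the `k`-th shift gives gauges of order `1 / (k n)`,
whose `α`-th powers have sum of order `k ^ (-α)` (`dominatedSets_subset_nullSets`).

Strictness comes from Cantor sets: images of `[0, 1)` under a coding `f` for which agreement to `j`
digits in base `q` means distance below `d j = s (n j)`. A set of diameter below `d j` then meets at
most one cylinder of level `j`, so its preimage has Lebesgue measure at most `q⁻ʲ`, and covers can
be tested against that measure. With `n j` proportional to `q ^ j` the image has positive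
`φ`-measure but is dominated, because different parts of it may be covered at different depths. With
`n j` of order `q ^ j / (j + 1) ^ 2` the series of `q⁻ʲ n (j + 1)` converges, so the image is not
dominated, while the polynomial loss is harmless for each `φ ^ α` with `α > 1`.

In `ℓ²` orthogonality realises every null sequence `d` as coding distances. In `ℝ` a digit expansion
does so if `d` drops by a factor `4 q` at each level, and `L < 2` supplies that drop. -/

/-! ### The two inclusions. -/

theorem Comparable.exists_forall {φ : ℝ≥0 → ℝ≥0} {s : ℕ+ → ℝ≥0} (h : Comparable φ s)
    (hφ : IsGauge φ) (hs : s ∈ nullSequences) :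
    ∃ a b : ℝ≥0, 0 < a ∧ 0 < b ∧
      ∀ n : ℕ+, a ≤ ((n : ℕ) : ℝ≥0) * φ (s n) ∧ ((n : ℕ) : ℝ≥0) * φ (s n) ≤ b := by
  obtain ⟨a, b, ha, hb, h⟩ := h
  obtain ⟨N, hN⟩ := eventually_atTop.1 h
  refine ⟨min a (φ (s N)), max b (((N : ℕ) : ℝ≥0) * φ (s 1)),
    lt_min ha (hφ.pos _ (hs.2.1 N)), lt_max_of_lt_left hb, fun n => ?_⟩
  rcases le_total N n with hn | hn
  · exact ⟨(min_le_left _ _).trans (hN n hn).1, (hN n hn).2.trans (le_max_left _ _)⟩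
  · constructor
    · refine (min_le_right _ _).trans ((hφ.mono (hs.1.antitone hn)).trans ?_)
      exact le_mul_of_one_le_left zero_le (by exact_mod_cast n.pos)
    · refine le_trans ?_ (le_max_right _ _)
      gcongr
      · exact_mod_cast hn
      · exact hφ.mono (hs.1.antitone one_le)

/-- Here `g n` is the rank of `n` by decreasing weight, ties broken by index: `B n` collects the
indices ranked up to `n`. Each of its members weighs at least `w n`, so rank times weight is at most
the total. Ranks are finite because the weights are positive and summable. -/
theorem exists_injective_mul_le_tsum (w : ℕ → ℝ≥0∞) (hw : ∀ n, 0 < w n) (h : ∑' n, w n ≠ ∞) :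
    ∃ g : ℕ → ℕ+, Function.Injective g ∧ ∀ n, ((g n : ℕ) : ℝ≥0∞) * w n ≤ ∑' m, w m := by
  let B : ℕ → Set ℕ := fun n => {m | w n < w m ∨ (w n = w m ∧ m ≤ n)}
  have hfin : ∀ n, (B n).Finite := fun n =>
    (ENNReal.finite_const_le_of_tsum_ne_top h (hw n).ne').subset fun m hm => by
      rcases hm with hm | hm
      · exact hm.le
      · exact hm.1.le
  have hmem : ∀ n, n ∈ B n := fun n => Or.inr ⟨rfl, le_rfl⟩
  have hpos : ∀ n, 0 < (B n).ncard := fun n => (Set.ncard_pos (hfin n)).2 ⟨n, hmem n⟩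
  have hlt : ∀ n m, n ∈ B m → n ≠ m → (B n).ncard < (B m).ncard := by
    intro n m hnm hne
    refine Set.ncard_lt_ncard ⟨fun x hx => ?_, fun hsub => ?_⟩ (hfin m)
    · rcases hnm with h1 | ⟨h1, h1'⟩ <;> rcases hx with h2 | ⟨h2, h2'⟩
      · exact Or.inl (h1.trans h2)
      · exact Or.inl (h1.trans_eq h2)
      · exact Or.inl (h1.trans_lt h2)
      · exact Or.inr ⟨h1.trans h2, h2'.trans h1'⟩
    · have h2 := hsub (hmem m)
      rcases hnm with h1 | ⟨h1, h1'⟩ <;> rcases h2 with h2 | ⟨h2, h2'⟩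
      · exact lt_asymm h1 h2
      · exact h1.ne h2.symm
      · exact h2.ne h1.symm
      · exact hne (le_antisymm h1' h2')
  refine ⟨fun n => ⟨(B n).ncard, hpos n⟩, fun n m hnm => ?_, fun n => ?_⟩
  · have hc : (B n).ncard = (B m).ncard := congrArg PNat.val hnm
    by_contra hne
    have : n ∈ B m ∨ m ∈ B n := by
      rcases lt_trichotomy (w n) (w m) with h1 | h1 | h1
      · exact Or.inr (Or.inl h1)
      · rcases le_total n m with h2 | h2
        · exact Or.inl (Or.inr ⟨h1.symm, h2⟩)
        · exact Or.inr (Or.inr ⟨h1, h2⟩)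
      · exact Or.inl (Or.inl h1)
    rcases this with h1 | h1
    · exact (hlt _ _ h1 hne).ne hc
    · exact (hlt _ _ h1 (Ne.symm hne)).ne hc.symm
  · have h1 : ∑ m ∈ (hfin n).toFinset, w n ≤ ∑ m ∈ (hfin n).toFinset, w m := by
      refine Finset.sum_le_sum fun m hm => ?_
      rcases (hfin n).mem_toFinset.1 hm with hm | hm
      · exact hm.le
      · exact hm.1.le
    rw [Finset.sum_const, nsmul_eq_mul, ← Set.ncard_eq_toFinset_card (B n) (hfin n)] at h1
    exact h1.trans (ENNReal.sum_le_tsum _)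

variable {X : Type*} [MetricSpace X]

theorem nullSets_subset_dominatedSets {φ : ℝ≥0 → ℝ≥0} {s : ℕ+ → ℝ≥0} (hφ : IsGauge φ)
    {a : ℝ≥0} (ha : 0 < a) (has : ∀ n : ℕ+, a ≤ ((n : ℕ) : ℝ≥0) * φ (s n))
    (hs : s ∈ nullSequences) :
    nullSets X φ ⊆ dominatedSets X (multClosure s) := by
  rintro E hE _ ⟨k, rfl⟩
  have hE0 : hausdorffGauge X φ E = 0 := hE
  have hε : (0 : ℝ≥0∞) < ((a / (k : ℕ) : ℝ≥0) : ℝ≥0∞) := by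
    have : (0 : ℝ≥0) < (k : ℕ) := by exact_mod_cast k.pos
    exact_mod_cast div_pos ha this
  set ε : ℝ≥0 := a / (k : ℕ) with hεdef
  rw [hausdorffGauge_apply hφ, ← nonpos_iff_eq_zero] at hE0
  have h1 := (iSup₂_le_iff.1 hE0 1 one_pos).trans_lt (ENNReal.half_pos hε.ne')
  simp only [iInf_lt_iff] at h1
  obtain ⟨A, hEA, hd, hsum⟩ := h1
  -- Infinitely many sets of the cover may have gauge zero, and they would get no finite rank. Small
  -- positive summable weights are added first.
  obtain ⟨w', hw'pos, hw'⟩ := ENNReal.exists_pos_sum_of_countable' (ENNReal.half_pos hε.ne').ne' ℕ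
  have hw : ∑' n, ((φ (Metric.ediam (A n)).toNNReal : ℝ≥0∞) + w' n) < ε := by
    rw [ENNReal.tsum_add, ← ENNReal.add_halves (ε : ℝ≥0∞)]
    exact ENNReal.add_lt_add hsum hw'
  obtain ⟨g, hg, hgw⟩ := exists_injective_mul_le_tsum
    (fun n => (φ (Metric.ediam (A n)).toNNReal : ℝ≥0∞) + w' n)
    (fun n => (hw'pos n).trans_le le_add_self) (hw.trans ENNReal.coe_lt_top).ne
  -- Indices that are not ranks receive the empty set, whose diameter is zero.
  refine ⟨Function.extend g A fun _ => ∅, fun m => ?_, fun x hx => ?_⟩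
  · by_cases hm : ∃ n, g n = m
    · obtain ⟨n, rfl⟩ := hm
      rw [hg.extend_apply]
      have hfin : Metric.ediam (A n) ≠ ∞ := ((hd n).trans ENNReal.coe_lt_top).ne
      rw [← ENNReal.coe_toNNReal hfin, ENNReal.coe_lt_coe]
      by_contra! hcon
      have h2 : ((g n : ℕ) : ℝ≥0∞) * (φ (Metric.ediam (A n)).toNNReal : ℝ≥0∞) < ε := by
        refine lt_of_le_of_lt ?_ ((hgw n).trans_lt hw)
        gcongr
        exact le_self_add
      have h3 : ((g n : ℕ) : ℝ≥0) * φ (Metric.ediam (A n)).toNNReal < ε := by exact_mod_cast h2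
      have h4 := has (k * g n)
      have h5 := hφ.mono hcon
      rw [hεdef, lt_div_iff₀ (by exact_mod_cast k.pos)] at h3
      refine absurd (h4.trans ?_) h3.not_ge
      rw [PNat.mul_coe, Nat.cast_mul, mul_comm ((k : ℕ) : ℝ≥0), mul_right_comm]
      exact mul_le_mul_left (mul_le_mul_right h5 _) _
    · rw [Function.extend_apply' _ _ _ hm]
      simpa [multShift] using hs.2.1 (k * m)
  · obtain ⟨n, hn⟩ := mem_iUnion.1 (hEA hx)
    exact mem_iUnion.2 ⟨g n, by rwa [hg.extend_apply]⟩

theorem IsGauge.gaugePow {φ : ℝ≥0 → ℝ≥0} (hφ : IsGauge φ) {α : ℝ} (hα : 0 < α) :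
    IsGauge (gaugePow φ α) where
  mono _ _ h := NNReal.rpow_le_rpow (hφ.mono h) hα.le
  right_continuous r :=
    (NNReal.continuous_rpow_const hα.le).continuousAt.comp_continuousWithinAt
      (hφ.right_continuous r)
  map_zero := by simp [DominatedSets.gaugePow, hφ.map_zero, hα.ne']
  pos r hr := NNReal.rpow_pos (hφ.pos r hr)

theorem mem_nullSets_of_tendsto {φ : ℝ≥0 → ℝ≥0} (hφ : IsGauge φ) {E : Set X}
    {u : ℕ → ℝ≥0∞} (hu : Tendsto u atTop (𝓝 0)) {r : ℕ → ℝ≥0} (hr : Tendsto r atTop (𝓝 0))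
    (h : ∀ᶠ k in atTop, ∃ A : ℕ → Set X, E ⊆ ⋃ n, A n ∧ (∀ n, Metric.ediam (A n) ≤ r k) ∧
      ∑' n, (φ (Metric.ediam (A n)).toNNReal : ℝ≥0∞) ≤ u k) :
    E ∈ nullSets X φ := by
  change hausdorffGauge X φ E = 0
  rw [hausdorffGauge_apply hφ, ← nonpos_iff_eq_zero]
  refine iSup₂_le fun δ hδ => ge_of_tendsto hu ?_
  filter_upwards [h, hr.eventually (gt_mem_nhds hδ)] with k ⟨A, hA, hd, hsum⟩ hk
  exact iInf_le_of_le A (iInf_le_of_le hA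
    (iInf_le_of_le (fun n => (hd n).trans_lt (ENNReal.coe_lt_coe.2 hk)) hsum))

theorem dominatedSets_subset_nullSets {φ : ℝ≥0 → ℝ≥0} {s : ℕ+ → ℝ≥0} (hφ : IsGauge φ)
    {b : ℝ≥0} (hbs : ∀ n : ℕ+, ((n : ℕ) : ℝ≥0) * φ (s n) ≤ b)
    (hs : s ∈ nullSequences) {α : ℝ} (hα : 1 < α) :
    dominatedSets X (multClosure s) ⊆ nullSets X (gaugePow φ α) := by
  intro E hE
  have hα0 : 0 < α := one_pos.trans hα
  have hS : Summable fun n : ℕ => (b / ((n + 1 : ℕ) : ℝ≥0)) ^ α := by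
    have h1 : Summable fun n : ℕ => (((n + 1 : ℕ) : ℝ≥0) ^ α)⁻¹ :=
      (NNReal.summable_nat_add_iff (f := fun n : ℕ => ((n : ℝ≥0) ^ α)⁻¹) 1).2
        (NNReal.summable_rpow_inv.2 hα)
    simpa only [NNReal.div_rpow, div_eq_mul_inv (b ^ α)] using h1.mul_left (b ^ α)
  -- The cover fine for the shift by `k + 1` has gauge sum at most `(k + 1) ^ (-α)` times a
  -- convergent series independent of `k`.
  refine mem_nullSets_of_tendsto (hφ.gaugePow hα0)
    (u := fun k => ((((k + 1 : ℕ) : ℝ≥0)⁻¹ ^ α : ℝ≥0) : ℝ≥0∞) *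
      ∑' n : ℕ, (((b / ((n + 1 : ℕ) : ℝ≥0)) ^ α : ℝ≥0) : ℝ≥0∞))
    (r := fun k => s k.succPNat) ?_ ?_ (Eventually.of_forall fun k => ?_)
  · have h1 : Tendsto (fun k : ℕ => (((k + 1 : ℕ) : ℝ≥0)⁻¹ ^ α : ℝ≥0)) atTop (𝓝 0) := by
      have h2 : Tendsto (fun k : ℕ => (((k + 1 : ℕ) : ℝ≥0)⁻¹)) atTop (𝓝 0) :=
        (tendsto_inv_atTop_nhds_zero_nat (𝕜 := ℝ≥0)).comp (tendsto_add_atTop_nat 1)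
      simpa [hα0.ne'] using h2.nnrpow (tendsto_const_nhds (x := α)) (Or.inr hα0)
    have h3 := ENNReal.Tendsto.mul_const (b := (∑' n : ℕ,
      (((b / ((n + 1 : ℕ) : ℝ≥0)) ^ α : ℝ≥0) : ℝ≥0∞))) (ENNReal.tendsto_coe.2 h1)
      (Or.inr (ENNReal.tsum_coe_ne_top_iff_summable.2 hS))
    simpa using h3
  · exact hs.2.2.comp (tendsto_atTop_atTop.2 fun n => ⟨n, fun m hm => by
      rw [← PNat.coe_le_coe, Nat.succPNat_coe]; omega⟩)
  · obtain ⟨A, hA, hEA⟩ := hE _ ⟨k.succPNat, rfl⟩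
    refine ⟨fun n => A n.succPNat, fun x hx => ?_, fun n => ?_, ?_⟩
    · obtain ⟨n, hn⟩ := mem_iUnion.1 (hEA hx)
      exact mem_iUnion.2 ⟨n.natPred, by rwa [PNat.succPNat_natPred]⟩
    · refine (hA _).le.trans ?_
      simp only [multShift, ENNReal.coe_le_coe]
      exact hs.1.antitone (by
        rw [← PNat.coe_le_coe, PNat.mul_coe]; exact Nat.le_mul_of_pos_right _ (PNat.pos _))
    · rw [← ENNReal.tsum_mul_left]
      refine ENNReal.tsum_le_tsum fun n => ?_
      rw [← ENNReal.coe_mul, ENNReal.coe_le_coe, ← NNReal.mul_rpow]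
      refine NNReal.rpow_le_rpow ?_ hα0.le
      have h1 : (Metric.ediam (A n.succPNat)).toNNReal ≤ s (k.succPNat * n.succPNat) :=
        ENNReal.toNNReal_mono ENNReal.coe_ne_top (hA _).le
      refine (hφ.mono h1).trans ?_
      have h2 := hbs (k.succPNat * n.succPNat)
      rw [PNat.mul_coe, Nat.succPNat_coe, Nat.succPNat_coe, Nat.cast_mul, mul_comm] at h2
      rw [inv_mul_eq_div, div_div, le_div_iff₀ (by positivity), mul_comm (_ : ℝ≥0) (Nat.cast (k+1))]
      exact h2

/-! ### Adic codings and Lebesgue measure. -/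

theorem one_le_tsum_volume_preimage {X ι : Type*} [Countable ι] {f : ℝ → X} {A : ι → Set X}
    (hA : f '' Ico 0 1 ⊆ ⋃ n, A n) :
    1 ≤ ∑' n, MeasureTheory.volume (Ico (0 : ℝ) 1 ∩ f ⁻¹' (A n)) := by
  have h1 : Ico (0 : ℝ) 1 ⊆ ⋃ n, (Ico (0 : ℝ) 1 ∩ f ⁻¹' (A n)) := by
    intro x hx
    obtain ⟨n, hn⟩ := mem_iUnion.1 (hA (mem_image_of_mem f hx))
    exact mem_iUnion.2 ⟨n, hx, hn⟩
  calc (1 : ℝ≥0∞) = MeasureTheory.volume (Ico (0 : ℝ) 1) := by simp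
    _ ≤ _ := (MeasureTheory.measure_mono h1).trans (MeasureTheory.measure_iUnion_le _)

/-- `f` codes the points of `[0, 1)` in a metric space so that two of them lie in the same `q`-adic
interval of length `q⁻ʲ` exactly when their images are at distance less than `d j`. -/
def IsAdicCoding {X : Type*} [MetricSpace X] (q : ℕ) (d : ℕ → ℝ≥0) (f : ℝ → X) : Prop :=
  ∀ x ∈ Ico (0 : ℝ) 1, ∀ y ∈ Ico (0 : ℝ) 1, ∀ j,
    ⌊(q : ℝ) ^ j * x⌋₊ = ⌊(q : ℝ) ^ j * y⌋₊ ↔ dist (f x) (f y) < d j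

namespace IsAdicCoding

variable {X : Type*} [MetricSpace X] {q : ℕ} {d : ℕ → ℝ≥0} {f : ℝ → X}

theorem ediam_image_le (hf : IsAdicCoding q d f) {S : Set ℝ} (hS : S ⊆ Ico 0 1) {j : ℕ}
    (h : ∀ x ∈ S, ∀ y ∈ S, ⌊(q : ℝ) ^ j * x⌋₊ = ⌊(q : ℝ) ^ j * y⌋₊) :
    Metric.ediam (f '' S) ≤ d j := by
  refine Metric.ediam_le ?_
  rintro _ ⟨x, hx, rfl⟩ _ ⟨y, hy, rfl⟩
  have h1 := (hf x (hS hx) y (hS hy) j).1 (h x hx y hy)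
  rw [edist_nndist, ENNReal.coe_le_coe]
  exact_mod_cast h1.le

theorem volume_preimage_le (hf : IsAdicCoding q d f) (hq : 0 < q) {A : Set X} {j : ℕ}
    (hA : Metric.ediam A < d j) :
    MeasureTheory.volume (Ico (0 : ℝ) 1 ∩ f ⁻¹' A) ≤ ((q : ℝ≥0∞) ^ j)⁻¹ := by
  rcases (Ico (0 : ℝ) 1 ∩ f ⁻¹' A).eq_empty_or_nonempty with h | ⟨x, hx, hxA⟩
  · simp [h]
  have hqj : (0 : ℝ) < (q : ℝ) ^ j := by positivity
  set m := ⌊(q : ℝ) ^ j * x⌋₊ with hm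
  have hsub : Ico (0 : ℝ) 1 ∩ f ⁻¹' A ⊆ Ico ((m : ℝ) / (q : ℝ) ^ j) ((m + 1 : ℝ) / (q : ℝ) ^ j) := by
    rintro y ⟨hy, hyA⟩
    have h1 : edist (f x) (f y) < d j := 
      (Metric.edist_le_ediam_of_mem (mem_preimage.1 hxA) (mem_preimage.1 hyA)).trans_lt hA
    rw [edist_nndist, ENNReal.coe_lt_coe] at h1
    have h2 := (hf x hx y hy j).2 (by exact_mod_cast h1)
    have h3 : (0 : ℝ) ≤ (q : ℝ) ^ j * y := mul_nonneg hqj.le hy.1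
    have h4 := (Nat.floor_eq_iff h3).1 (h2.symm.trans hm.symm)
    constructor
    · rw [div_le_iff₀' hqj]; exact h4.1
    · rw [lt_div_iff₀' hqj]; exact h4.2
  refine (MeasureTheory.measure_mono hsub).trans ?_
  rw [Real.volume_Ico, ← sub_div, add_sub_cancel_left, one_div,
    ENNReal.ofReal_inv_of_pos hqj, ENNReal.ofReal_pow (by positivity), ENNReal.ofReal_natCast]

/-- Mass distribution principle: the gauge of a set of small diameter dominates a constant times the
Lebesgue measure of its preimage. If `d (j + 1) ≤ r < d j`, that measure is at most `q⁻ʲ`, while `φ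
r ≥ φ (d (j + 1)) ≥ c q⁻⁽ʲ⁺¹⁾`; the lost level accounts for the constant `c / q`. -/
theorem image_notMem_nullSets {φ : ℝ≥0 → ℝ≥0} (hφ : IsGauge φ) (hf : IsAdicCoding q d f)
    (hq : 2 ≤ q) (hd : StrictAnti d) (hd0 : ∀ j, 0 < d j) (hd1 : Tendsto d atTop (𝓝 0))
    {c : ℝ≥0} (hc : ∀ j, c ≤ (q : ℝ≥0) ^ j * φ (d j)) (hc0 : 0 < c) :
    f '' Ico 0 1 ∉ nullSets X φ := by
  intro h
  have h0 : hausdorffGauge X φ (f '' Ico 0 1) = 0 := h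
  have hqpos : 0 < q := by omega
  have hqc : (0 : ℝ≥0) < c / q := div_pos hc0 (by exact_mod_cast hqpos)
  rw [hausdorffGauge_apply hφ, ← nonpos_iff_eq_zero] at h0
  have h1 := (iSup₂_le_iff.1 h0 (d 0) (hd0 0)).trans_lt (ENNReal.coe_pos.2 hqc)
  simp only [iInf_lt_iff] at h1
  obtain ⟨A, hEA, hdA, hsum⟩ := h1
  have key : ∀ n, ((c / q : ℝ≥0) : ℝ≥0∞) * MeasureTheory.volume (Ico (0 : ℝ) 1 ∩ f ⁻¹' (A n)) ≤
      (φ (Metric.ediam (A n)).toNNReal : ℝ≥0∞) := by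
    intro n
    have hfin : Metric.ediam (A n) ≠ ∞ := ((hdA n).trans ENNReal.coe_lt_top).ne
    have hr := hdA n
    rw [← ENNReal.coe_toNNReal hfin] at hr
    set r := (Metric.ediam (A n)).toNNReal with hrdef
    -- A set of diameter zero lies below every `d j`, so its preimage is Lebesgue null.
    rcases eq_or_lt_of_le (zero_le (a := r)) with hr0 | hr0
    · have hv : MeasureTheory.volume (Ico (0 : ℝ) 1 ∩ f ⁻¹' (A n)) = 0 := by
        have hlim : Tendsto (fun j : ℕ => ((q : ℝ≥0∞) ^ j)⁻¹) atTop (𝓝 0) := by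
          have h2 : ((q : ℝ≥0∞))⁻¹ < 1 := ENNReal.inv_lt_one.2 (by exact_mod_cast hq)
          simpa only [ENNReal.inv_pow] using ENNReal.tendsto_pow_atTop_nhds_zero_of_lt_one h2
        refine le_antisymm (ge_of_tendsto' hlim fun j => hf.volume_preimage_le hqpos ?_) zero_le
        rw [← ENNReal.coe_toNNReal hfin, ← hrdef, ← hr0]
        exact ENNReal.coe_pos.2 (hd0 j)
      simp [hv]
    · obtain ⟨J, hJ⟩ := (hd1.eventually (ge_mem_nhds hr0)).exists
      have hex : ∃ j, d (j + 1) ≤ r := ⟨J, (hd.antitone (Nat.le_succ J)).trans hJ⟩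
      classical
      have hj1 := Nat.find_spec hex
      have hj2 : r < d (Nat.find hex) := by
        rcases Nat.eq_zero_or_pos (Nat.find hex) with h0 | h0
        · rw [h0]; exact_mod_cast hr
        · have := Nat.find_min hex (Nat.sub_lt h0 one_pos)
          rw [Nat.sub_add_cancel (Nat.one_le_iff_ne_zero.2 h0.ne')] at this
          exact not_le.1 this
      set j := Nat.find hex
      have hv := hf.volume_preimage_le hqpos (A := A n) (j := j) (by
        rw [← ENNReal.coe_toNNReal hfin]; exact_mod_cast hj2)
      have hb : c / q * ((q : ℝ≥0) ^ j)⁻¹ ≤ φ r := by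
        refine le_trans ?_ (hφ.mono hj1)
        have hq0 : (0 : ℝ≥0) < q := by exact_mod_cast hqpos
        rw [← div_eq_mul_inv, div_div, div_le_iff₀' (by positivity), ← pow_succ']
        exact hc (j + 1)
      calc _ ≤ ((c / q : ℝ≥0) : ℝ≥0∞) * ((q : ℝ≥0∞) ^ j)⁻¹ := by gcongr
        _ = ((c / q * ((q : ℝ≥0) ^ j)⁻¹ : ℝ≥0) : ℝ≥0∞) := by
          have hq0 : (q : ℝ≥0) ^ j ≠ 0 := by positivity
          rw [ENNReal.coe_mul, ENNReal.coe_inv hq0, ENNReal.coe_pow, ENNReal.coe_natCast]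
        _ ≤ _ := by exact_mod_cast hb
  have h2 : ((c / q : ℝ≥0) : ℝ≥0∞) * 1 ≤ ∑' n, (φ (Metric.ediam (A n)).toNNReal : ℝ≥0∞) := by
    refine (mul_le_mul_right (one_le_tsum_volume_preimage hEA) _).trans ?_
    rw [← ENNReal.tsum_mul_left]
    exact ENNReal.tsum_le_tsum key
  rw [mul_one] at h2
  exact absurd hsum h2.not_gt

/-- Covering everything at one depth would not beat the shift by `k`. Instead the cylinders of level
`t + 1` are numbered by `u`, and cylinder `u` is covered by its `q ^ u` subcylinders of level `t + 1
+ u`. These take indices in the block from `q ^ u` to `q ^ (u + 1)`; the blocks are disjoint for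
different `u`, and `k < q ^ t` leaves room for the shift. -/
theorem image_mem_dominatedSets {s : ℕ+ → ℝ≥0} (hs : StrictAnti s) {K : ℕ+}
    (hq : 2 ≤ q) (hf : IsAdicCoding q d f)
    (hd : ∀ j (n : ℕ+), (n : ℕ) < K * q ^ j → d j < s n) :
    f '' Ico 0 1 ∈ dominatedSets X (multClosure s) := by
  rintro _ ⟨k, rfl⟩
  obtain ⟨t, ht⟩ : ∃ t, (k : ℕ) < q ^ t := ⟨(k : ℕ), Nat.lt_pow_self (by omega)⟩
  let u : ℝ → ℕ := fun x => ⌊(q : ℝ) ^ (t + 1) * x⌋₊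
  let v : ℝ → ℕ := fun x => ⌊(q : ℝ) ^ (t + 1 + u x) * x⌋₊
  have hqpos : 0 < q := by omega
  have hpos : ∀ i, 0 < q ^ i := fun i => by positivity
  have huv : ∀ x, v x / q ^ u x = u x := by
    intro x
    simp only [v]
    rw [← Nat.floor_div_natCast, Nat.cast_pow, pow_add, mul_right_comm,
      mul_div_cancel_right₀ _ (by positivity)]
  -- The index of the subcylinder containing `x`. Its base-`q` logarithm recovers `u x`, and its
  -- remainder then recovers `v x`.
  let N : ℝ → ℕ := fun x => q ^ u x + v x % q ^ u x
  have hN1 : ∀ x, q ^ u x ≤ N x := fun x => Nat.le_add_right _ _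
  have hN2 : ∀ x, N x < q ^ (u x + 1) := by
    intro x
    have h1 : v x % q ^ u x < q ^ u x := Nat.mod_lt _ (hpos _)
    have h2 : 2 * q ^ u x ≤ q ^ (u x + 1) := by
      rw [pow_succ']; exact Nat.mul_le_mul_right _ hq
    simp only [N]; omega
  have hlog : ∀ x, Nat.log q (N x) = u x := fun x =>
    Nat.log_eq_of_pow_le_of_lt_pow (hN1 x) (hN2 x)
  have hNpos : ∀ x, 0 < N x := fun x => (hpos _).trans_le (hN1 x)
  refine ⟨fun n => f '' {x ∈ Ico (0 : ℝ) 1 | N x = n}, fun n => ?_, ?_⟩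
  · rcases {x ∈ Ico (0 : ℝ) 1 | N x = n}.eq_empty_or_nonempty with h | ⟨x, hx, hxn⟩
    · simp only [h, image_empty, Metric.ediam_empty]
      rw [ENNReal.coe_pos]
      exact (zero_le).trans_lt (hs (PNat.lt_add_right (k * n) 1))
    · have h1 : Metric.ediam (f '' {x ∈ Ico (0 : ℝ) 1 | N x = n}) ≤ d (t + 1 + u x) := by
        refine hf.ediam_image_le (fun y hy => hy.1) ?_
        have key : ∀ y, N y = n → ⌊(q : ℝ) ^ (t + 1 + u x) * y⌋₊ = v x := by
          intro y hy
          have hyx : N y = N x := hy.trans hxn.symm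
          have hu : u y = u x := by rw [← hlog y, ← hlog x, hyx]
          have hmod : v y % q ^ u y = v x % q ^ u x := by
            simp only [N, hu] at hyx ⊢
            omega
          have hv : v y = v x := by
            rw [← Nat.div_add_mod (v y) (q ^ u y), ← Nat.div_add_mod (v x) (q ^ u x),
              huv, huv, hmod, hu]
          rw [← hv, ← hu]
        intro y hy z hz
        rw [key y hy.2, key z hz.2]
      refine h1.trans_lt (ENNReal.coe_lt_coe.2 (hd _ _ ?_))
      have h2 : (n : ℕ) < q ^ (u x + 1) := hxn ▸ hN2 x
      have h3 : q ^ (t + 1 + u x) = q ^ t * q ^ (u x + 1) := by rw [← pow_add]; congr 1; ring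
      rw [PNat.mul_coe, h3]
      calc (k : ℕ) * n < q ^ t * q ^ (u x + 1) := Nat.mul_lt_mul'' ht h2
        _ ≤ K * (q ^ t * q ^ (u x + 1)) := Nat.le_mul_of_pos_left _ K.pos
  · rintro _ ⟨x, hx, rfl⟩
    exact mem_iUnion.2 ⟨⟨N x, hNpos x⟩, x, ⟨hx, rfl⟩, rfl⟩

/-- In a cover fine for the shift by `k`, the `m`-th set has preimage of measure at most `q⁻ʲ` when
`n j ≤ k * m < n (j + 1)`. At most `n (j + 1) / k` indices `m` belong to level `j`, so the total
measure is at most `S / k`, which is below `1` for large `k`. -/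
theorem image_notMem_dominatedSets {s : ℕ+ → ℝ≥0} (hs : StrictAnti s) {n : ℕ → ℕ+}
    (hq : 2 ≤ q) (hf : IsAdicCoding q (fun j => s (n j)) f) (hn : StrictMono n)
    (hsum : ∑' j, ((q : ℝ≥0∞) ^ j)⁻¹ * (n (j + 1) : ℕ) ≠ ∞) :
    f '' Ico 0 1 ∉ dominatedSets X (multClosure s) := by
  intro h
  have hqpos : 0 < q := by omega
  set S := ∑' j, ((q : ℝ≥0∞) ^ j)⁻¹ * (n (j + 1) : ℕ)
  obtain ⟨k0, hk0⟩ := ENNReal.exists_nat_gt hsum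
  -- Besides exceeding `S`, the shift must be at least `n 0`, so that every `k * m` lies beyond the
  -- first scale.
  let k : ℕ+ := n 0 + ⟨k0 + 1, k0.succ_pos⟩
  have hkS : S < (k : ℕ) := hk0.trans_le (by
    have h1 : (k : ℕ) = n 0 + (k0 + 1) := rfl
    exact_mod_cast (by omega : k0 ≤ (k : ℕ)))
  have hkn0 : n 0 ≤ k := (PNat.lt_add_right _ _).le
  obtain ⟨A, hA, hEA⟩ := h _ ⟨k, rfl⟩
  -- Only the least `j` with `k * m < n (j + 1)` is needed; summing over all such `j` allows the
  -- order of summation to be exchanged.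
  have hvol : ∀ m : ℕ+, MeasureTheory.volume (Ico (0 : ℝ) 1 ∩ f ⁻¹' (A m)) ≤
      ∑' j, if k * m < n (j + 1) then ((q : ℝ≥0∞) ^ j)⁻¹ else 0 := by
    intro m
    have hex : ∃ j, k * m < n (j + 1) := by
      refine ⟨k * m, ?_⟩
      have h1 : (k * m : ℕ) < (n (k * m + 1) : ℕ) :=
        (Nat.lt_succ_self _).trans_le (StrictMono.le_apply (f := fun j => (n j : ℕ)) (fun _ _ h => hn h))
      exact_mod_cast h1
    classical
    have h1 := Nat.find_spec hex
    have h2 : n (Nat.find hex) ≤ k * m := by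
      rcases Nat.eq_zero_or_pos (Nat.find hex) with h0 | h0
      · rw [h0]
        refine hkn0.trans ?_
        rw [← PNat.coe_le_coe, PNat.mul_coe]
        exact Nat.le_mul_of_pos_right _ m.pos
      · have := Nat.find_min hex (Nat.sub_lt h0 one_pos)
        rw [Nat.sub_add_cancel (Nat.one_le_iff_ne_zero.2 h0.ne')] at this
        exact not_lt.1 this
    have h3 := hf.volume_preimage_le hqpos (A := A m) (j := Nat.find hex)
      ((hA m).trans_le (ENNReal.coe_le_coe.2 (hs.antitone h2)))
    refine h3.trans ?_
    refine le_trans ?_ (ENNReal.le_tsum (Nat.find hex))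
    rw [if_pos h1]
  have hcount : ∀ j, ((k : ℕ) : ℝ≥0∞) *
      ∑' m : ℕ+, (if k * m < n (j + 1) then ((q : ℝ≥0∞) ^ j)⁻¹ else 0) ≤
        ((q : ℝ≥0∞) ^ j)⁻¹ * (n (j + 1) : ℕ) := by
    intro j
    let F : Finset ℕ+ := (Finset.range ((n (j + 1) : ℕ) / k)).map
      ⟨Nat.succPNat, Nat.succPNat_injective⟩
    have hF : ∀ m ∉ F, (if k * m < n (j + 1) then ((q : ℝ≥0∞) ^ j)⁻¹ else 0) = 0 := by
      intro m hm
      rw [if_neg]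
      contrapose! hm
      refine Finset.mem_map.2 ⟨m.natPred, Finset.mem_range.2 ?_, PNat.succPNat_natPred m⟩
      have h1 : (k * m : ℕ) < n (j + 1) := by exact_mod_cast hm
      have h2 : (m : ℕ) ≤ (n (j + 1) : ℕ) / k := by
        rw [Nat.le_div_iff_mul_le k.pos, mul_comm]; exact h1.le
      have h3 := PNat.natPred_add_one m
      omega
    rw [tsum_eq_sum hF]
    have h1 : ∑ m ∈ F, (if k * m < n (j + 1) then ((q : ℝ≥0∞) ^ j)⁻¹ else 0) ≤
        (((n (j + 1) : ℕ) / k : ℕ) : ℝ≥0∞) * ((q : ℝ≥0∞) ^ j)⁻¹ := by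
      refine (Finset.sum_le_sum fun m _ => (?_ : _ ≤ ((q : ℝ≥0∞) ^ j)⁻¹)).trans ?_
      · split_ifs <;> simp
      · simp [F]
    calc _ ≤ ((k : ℕ) : ℝ≥0∞) * ((((n (j + 1) : ℕ) / k : ℕ) : ℝ≥0∞) * ((q : ℝ≥0∞) ^ j)⁻¹) := by
          gcongr
      _ = ((k * ((n (j + 1) : ℕ) / k) : ℕ) : ℝ≥0∞) * ((q : ℝ≥0∞) ^ j)⁻¹ := by
          rw [Nat.cast_mul, mul_assoc]
      _ ≤ _ := by
          rw [mul_comm]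
          gcongr
          exact Nat.mul_div_le _ _
  have h1 := (one_le_tsum_volume_preimage hEA).trans (ENNReal.tsum_le_tsum hvol)
  rw [ENNReal.tsum_comm] at h1
  have h2 := mul_le_mul_right h1 ((k : ℕ) : ℝ≥0∞)
  rw [← ENNReal.tsum_mul_left, mul_one] at h2
  exact absurd hkS (h2.trans (ENNReal.tsum_le_tsum hcount)).not_gt

theorem image_mem_nullSets {φ : ℝ≥0 → ℝ≥0} (hφ : IsGauge φ) (hf : IsAdicCoding q d f)
    (hq : 0 < q) (hd1 : Tendsto d atTop (𝓝 0))
    (h : Tendsto (fun j => (q : ℝ≥0) ^ j * φ (d j)) atTop (𝓝 0)) :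
    f '' Ico 0 1 ∈ nullSets X φ := by
  refine mem_nullSets_of_tendsto hφ (u := fun j => (((q : ℝ≥0) ^ j * φ (d j) : ℝ≥0) : ℝ≥0∞))
    (ENNReal.tendsto_coe.2 h) hd1 (Eventually.of_forall fun j => ?_)
  have hle : ∀ i, Metric.ediam (f '' {x ∈ Ico (0 : ℝ) 1 | ⌊(q : ℝ) ^ j * x⌋₊ = i}) ≤ d j :=
    fun i => hf.ediam_image_le (fun x hx => hx.1) fun x hx y hy => hx.2.trans hy.2.symm
  refine ⟨fun i => f '' {x ∈ Ico (0 : ℝ) 1 | ⌊(q : ℝ) ^ j * x⌋₊ = i}, ?_, hle, ?_⟩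
  · rintro _ ⟨x, hx, rfl⟩
    exact mem_iUnion.2 ⟨_, x, ⟨hx, rfl⟩, rfl⟩
  · rw [tsum_eq_sum (s := Finset.range (q ^ j))]
    · refine (Finset.sum_le_sum fun i _ => ENNReal.coe_le_coe.2
        (hφ.mono (ENNReal.toNNReal_mono ENNReal.coe_ne_top (hle i)))).trans ?_
      simp
    · intro i hi
      have : {x ∈ Ico (0 : ℝ) 1 | ⌊(q : ℝ) ^ j * x⌋₊ = i} = ∅ := by
        refine eq_empty_of_forall_notMem fun x hx => hi (Finset.mem_range.2 ?_)
        rw [← hx.2, Nat.floor_lt (mul_nonneg (by positivity) hx.1.1), Nat.cast_pow]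
        exact mul_lt_of_lt_one_right (by positivity) hx.1.2
      simp only [this]
      simp [hφ.map_zero]

end IsAdicCoding
-- Construction of codings in `ℓ²` and in `ℝ`.
theorem floor_pow_mul_eq_of_le {q : ℕ} (hq : 0 < q) {x y : ℝ} {i j : ℕ} (hij : i ≤ j)
    (h : ⌊(q : ℝ) ^ j * x⌋₊ = ⌊(q : ℝ) ^ j * y⌋₊) :
    ⌊(q : ℝ) ^ i * x⌋₊ = ⌊(q : ℝ) ^ i * y⌋₊ := by
  have key : ∀ z : ℝ, ⌊(q : ℝ) ^ i * z⌋₊ = ⌊(q : ℝ) ^ j * z⌋₊ / q ^ (j - i) := by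
    intro z
    rw [← Nat.floor_div_natCast, Nat.cast_pow, ← Nat.add_sub_of_le hij, pow_add, mul_right_comm,
      Nat.add_sub_cancel_left, mul_div_cancel_right₀ _ (by positivity)]
  rw [key, key, h]

theorem hasSum_sub_succ {r : ℕ → ℝ} (hr : Antitone r) (h0 : Tendsto r atTop (𝓝 0)) (j : ℕ) :
    HasSum (fun i => if i < j then 0 else r i - r (i + 1)) (r j) := by
  have h1 : HasSum (fun i => r (i + j) - r (i + j + 1)) (r j) := by
    rw [hasSum_iff_tendsto_nat_of_nonneg fun i => sub_nonneg.2 (hr (Nat.le_succ _))]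
    have h2 : ∀ n, ∑ i ∈ Finset.range n, (r (i + j) - r (i + j + 1)) = r j - r (n + j) := by
      intro n
      have := Finset.sum_range_sub' (fun i => r (i + j)) n
      simp only [zero_add] at this
      rw [← this]
      exact Finset.sum_congr rfl fun i _ => by rw [add_right_comm]
    simp only [h2]
    simpa using tendsto_const_nhds.sub (h0.comp (tendsto_add_atTop_nat j))
  have h3 := (hasSum_nat_add_iff (f := fun i => if i < j then 0 else r i - r (i + 1)) j
    (g := r j)).1 (by simpa using h1)
  rwa [Finset.sum_eq_zero, add_zero] at h3
  intro i hi
  simp [Finset.mem_range.1 hi]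

theorem hasSum_prod_of_nonneg {F : ℕ × ℕ → ℝ} (hF : ∀ p, 0 ≤ F p) {G : ℕ → ℝ}
    (hFG : ∀ j, HasSum (fun m => F (j, m)) (G j)) (hG : Summable G) :
    HasSum F (∑' j, G j) := by
  have h1 : Summable F := by
    refine (summable_prod_of_nonneg hF).2 ⟨fun j => (hFG j).summable, ?_⟩
    simpa only [(hFG _).tsum_eq] using hG
  have h2 := h1.hasSum.prod_fiberwise hFG
  rw [h2.tsum_eq]
  exact h1.hasSum

/-- The family supported on the graph of `u : ℕ → ℕ` that takes the value `c j` at `(j, u j)`. -/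
noncomputable def branchFun (c : ℕ → ℝ) (u : ℕ → ℕ) (p : ℕ × ℕ) : ℝ :=
  if p.2 = u p.1 then c p.1 else 0

theorem hasSum_branchFun_sq {c : ℕ → ℝ} (hc : Summable fun j => c j ^ 2) (u : ℕ → ℕ) :
    HasSum (fun p => branchFun c u p ^ 2) (∑' j, c j ^ 2) := by
  refine hasSum_prod_of_nonneg (fun p => sq_nonneg _) (fun j => ?_) hc
  have h := hasSum_single (f := fun m => branchFun c u (j, m) ^ 2) (u j)
    (fun m hm => by simp [branchFun, hm])
  simpa [branchFun] using h

theorem hasSum_branchFun_sub_sq {c : ℕ → ℝ} (hc : Summable fun j => c j ^ 2) (u v : ℕ → ℕ) :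
    HasSum (fun p => (branchFun c u p - branchFun c v p) ^ 2)
      (∑' j, if u j = v j then 0 else 2 * c j ^ 2) := by
  refine hasSum_prod_of_nonneg (fun p => sq_nonneg _) (fun j => ?_) ?_
  · have h := hasSum_sum_of_ne_finset_zero (L := .unconditional ℕ) (s := {u j, v j})
      (f := fun m => (branchFun c u (j, m) - branchFun c v (j, m)) ^ 2) (fun m hm => by
        simp only [Finset.mem_insert, Finset.mem_singleton, not_or] at hm
        simp [branchFun, hm.1, hm.2])
    by_cases huv : u j = v j
    · simp [branchFun, huv]
    · rw [Finset.sum_pair huv] at h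
      simpa [branchFun, huv, Ne.symm huv, two_mul] using h
  · refine Summable.of_nonneg_of_le (fun j => ?_) (fun j => ?_) (hc.mul_left 2)
    · split_ifs <;> positivity
    · split_ifs
      · positivity
      · exact le_rfl

/-- A point is sent to the sum over `j` of `c j` times the basis vector attached to its level-`j`
cylinder. Two points contribute `2 * c j ^ 2` to the squared distance at each level where their
cylinders differ. Once cylinders differ they differ at all later levels, so the choice of `c` makes
the sum telescope to `d i ^ 2` with `i` the first differing level. -/
theorem exists_isAdicCoding_ellTwo {q : ℕ} (hq : 0 < q) {d : ℕ → ℝ≥0} (hd : StrictAnti d)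
    (hd0 : Tendsto d atTop (𝓝 0)) : ∃ f : ℝ → EllTwo, IsAdicCoding q d f := by
  let r : ℕ → ℝ := fun j => (d j : ℝ) ^ 2
  have hr : StrictAnti r := fun i j hij =>
    pow_lt_pow_left₀ (NNReal.coe_lt_coe.2 (hd hij)) (d j).2 two_ne_zero
  have hr0 : Tendsto r atTop (𝓝 0) := by
    simpa using (NNReal.tendsto_coe.2 hd0).pow 2
  let c : ℕ → ℝ := fun j => √((r j - r (j + 1)) / 2)
  have hc2 : ∀ j, 2 * c j ^ 2 = r j - r (j + 1) := fun j => by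
    rw [Real.sq_sqrt (by linarith [hr (Nat.lt_succ_self j)])]; ring
  have hcs : Summable fun j => c j ^ 2 := by
    have h1 := (hasSum_sub_succ hr.antitone hr0 0).summable.mul_left (1 / 2)
    refine h1.congr fun j => ?_
    simp only [not_lt_zero, if_false]
    linarith [hc2 j]
  obtain ⟨e⟩ : Nonempty (ℕ+ ≃ ℕ × ℕ) := ⟨Denumerable.equiv₂ _ _⟩
  let u : ℝ → ℕ → ℕ := fun x j => ⌊(q : ℝ) ^ j * x⌋₊
  obtain ⟨F, hF⟩ : ∃ F : ℝ → EllTwo, ∀ x i, F x i = branchFun c (u x) (e i) := by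
    refine ⟨fun x => ⟨fun i => branchFun c (u x) (e i), memℓp_gen ?_⟩, fun _ _ => rfl⟩
    have h1 := (e.summable_iff (f := fun p => branchFun c (u x) p ^ 2)).2
      (hasSum_branchFun_sq hcs (u x)).summable
    simpa [Function.comp_def] using h1
  refine ⟨F, fun x _ y _ j => ?_⟩
  have hdist : dist (F x) (F y) ^ 2 =
      ∑' i, if u x i = u y i then 0 else r i - r (i + 1) := by
    have h1 := lp.norm_rpow_eq_tsum (p := 2) (by simp) (F x - F y)
    have h2 := (e.hasSum_iff (f := fun p => (branchFun c (u x) p - branchFun c (u y) p) ^ 2)).2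
      (hasSum_branchFun_sub_sq hcs (u x) (u y))
    rw [dist_eq_norm]
    simp only [hc2] at h2
    rw [← h2.tsum_eq]
    simpa [Function.comp_def, hF] using h1
  have hs : Summable fun i => if u x i = u y i then 0 else r i - r (i + 1) := by
    refine Summable.of_nonneg_of_le (fun i => ?_) (fun i => ?_)
      (hasSum_sub_succ hr.antitone hr0 0).summable
    · split_ifs
      · exact le_rfl
      · exact (sub_pos.2 (hr (Nat.lt_succ_self i))).le
    · simp only [not_lt_zero, if_false]
      split_ifs
      · exact (sub_pos.2 (hr (Nat.lt_succ_self i))).le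
      · exact le_rfl
  refine Iff.trans ?_ (sq_lt_sq₀ dist_nonneg (d j).2)
  rw [hdist]
  constructor
  · intro h
    refine (hasSum_le (fun i => ?_) hs.hasSum
      (hasSum_sub_succ hr.antitone hr0 (j + 1))).trans_lt (hr (Nat.lt_succ_self j))
    by_cases hij : i < j + 1
    · rw [if_pos (show u x i = u y i from floor_pow_mul_eq_of_le hq (Nat.lt_succ_iff.1 hij) h)]
      simp [hij]
    · rw [if_neg hij]
      split_ifs
      · exact (sub_pos.2 (hr (Nat.lt_succ_self i))).le
      · exact le_rfl
  · intro h
    by_contra hne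
    refine absurd h (not_lt.2 (hasSum_le (fun i => ?_)
      (hasSum_sub_succ hr.antitone hr0 j) hs.hasSum))
    by_cases hij : i < j
    · rw [if_pos hij]
      split_ifs
      · exact le_rfl
      · exact (sub_pos.2 (hr (Nat.lt_succ_self i))).le
    · rw [if_neg hij, if_neg fun h => hne (floor_pow_mul_eq_of_le hq (not_lt.1 hij) h)]

/-- The digits of `x` are reused with new weights `t j = d j / (2 q)`. As `4 q ≥ 8`, the `d j` decay
at least like powers of `1 / 8`, and the levels from `j` on contribute at most `(d j / 2) * (8 / 7)
= (4 / 7) * d j`. A first difference in digit `j` contributes at least `t j ≥ 2 * d (j + 1)`, which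
the later levels cannot bring below `d (j + 1)`. -/
theorem exists_isAdicCoding_real {q : ℕ} (hq : 2 ≤ q) {d : ℕ → ℝ≥0} (hd0 : ∀ j, 0 < d j)
    (hd : ∀ j, 4 * q * d (j + 1) ≤ d j) : ∃ f : ℝ → ℝ, IsAdicCoding q d f := by
  have hqpos : 0 < q := by omega
  have hq2 : (2 : ℝ) ≤ q := by exact_mod_cast hq
  have hd' : ∀ j, 4 * (q : ℝ) * d (j + 1) ≤ d j := fun j => by exact_mod_cast hd j
  have hdp : ∀ j, (0 : ℝ) < d j := fun j => by exact_mod_cast hd0 j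
  have hstep : ∀ j, (d (j + 1) : ℝ) ≤ d j * (1 / 8) := fun j => by
    nlinarith [hd' j, hdp (j + 1)]
  have hgeo : ∀ j i, (d (i + j) : ℝ) ≤ d j * (1 / 8) ^ i := by
    intro j i
    induction i with
    | zero => simp
    | succ i ih =>
      rw [add_right_comm, pow_succ]
      linarith [hstep (i + j)]
  let D : ℝ → ℕ → ℕ := fun x j => ⌊(q : ℝ) ^ (j + 1) * x⌋₊ % q
  let t : ℕ → ℝ := fun j => d j / (2 * q)
  have htp : ∀ j, 0 < t j := fun j => div_pos (hdp j) (by positivity)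
  have hqt : ∀ j, q * t j = d j / 2 := fun j => by
    simp only [t]; field_simp
  have hDq : ∀ x j, (D x j : ℝ) ≤ q := fun x j => by
    exact_mod_cast (Nat.mod_lt _ hqpos).le
  have hdiv : ∀ x j, ⌊(q : ℝ) ^ (j + 1) * x⌋₊ / q = ⌊(q : ℝ) ^ j * x⌋₊ := fun x j => by
    rw [← Nat.floor_div_natCast, pow_succ, mul_right_comm, mul_div_cancel_right₀ _ (by positivity)]
  have hgeosum : ∀ C : ℝ, HasSum (fun i : ℕ => C / 2 * (1 / 8 : ℝ) ^ i) (4 / 7 * C) := fun C => by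
    have h := (hasSum_geometric_of_lt_one (r := (1 / 8 : ℝ)) (by norm_num) (by norm_num)).mul_left
      (C / 2)
    rwa [show C / 2 * (1 - 1 / 8 : ℝ)⁻¹ = 4 / 7 * C by norm_num; ring] at h
  have hsum : ∀ x, Summable fun j => (D x j : ℝ) * t j := by
    intro x
    refine Summable.of_nonneg_of_le (fun j => mul_nonneg (Nat.cast_nonneg _) (htp j).le)
      (fun j => ?_) (hgeosum (d 0)).summable
    have h1 := mul_le_mul_of_nonneg_right (hDq x j) (htp j).le
    have h2 := hgeo 0 j
    rw [hqt] at h1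
    simp only [add_zero] at h2
    linarith
  refine ⟨fun x => ∑' j, (D x j : ℝ) * t j, fun x _ y _ j => ?_⟩
  let g : ℕ → ℝ := fun i => D x i * t i - D y i * t i
  have hg : Summable g := (hsum x).sub (hsum y)
  have hdist : dist (∑' j, (D x j : ℝ) * t j) (∑' j, (D y j : ℝ) * t j) = |∑' i, g i| := by
    rw [Real.dist_eq, ← (hsum x).tsum_sub (hsum y)]
  have htail : ∀ j, |∑' i, g (i + j)| ≤ 4 / 7 * d j := by
    intro j
    rw [← Real.norm_eq_abs]
    refine tsum_of_norm_bounded (hgeosum (d j)) fun i => ?_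
    have h1 := mul_le_mul_of_nonneg_right (hDq x (i + j)) (htp (i + j)).le
    have h2 := mul_le_mul_of_nonneg_right (hDq y (i + j)) (htp (i + j)).le
    have h3 := mul_nonneg (Nat.cast_nonneg (α := ℝ) (D x (i + j))) (htp (i + j)).le
    have h4 := mul_nonneg (Nat.cast_nonneg (α := ℝ) (D y (i + j))) (htp (i + j)).le
    have h5 := hgeo j i
    rw [hqt] at h1 h2
    rw [Real.norm_eq_abs, abs_le]
    constructor <;> simp only [g] <;> linarith
  have hzero : ∀ j, ⌊(q : ℝ) ^ j * x⌋₊ = ⌊(q : ℝ) ^ j * y⌋₊ → ∀ i < j, g i = 0 := by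
    intro j h i hi
    have h1 : D x i = D y i := by
      simp only [D]
      rw [floor_pow_mul_eq_of_le hqpos (Nat.succ_le_of_lt hi) h]
    simp only [g, h1, sub_self]
  have hsplit : ∀ j, ⌊(q : ℝ) ^ j * x⌋₊ = ⌊(q : ℝ) ^ j * y⌋₊ → ∑' i, g i = ∑' i, g (i + j) := by
    intro j h
    rw [← hg.sum_add_tsum_nat_add j, Finset.sum_eq_zero fun i hi =>
      hzero j h i (Finset.mem_range.1 hi), zero_add]
  rw [hdist]
  constructor
  · intro h
    rw [hsplit j h]
    linarith [htail j, hdp j]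
  · intro h
    -- Distance below `d (j + 1)` is also below `d j`, so by induction the first `j` digits agree
    -- and only digit `j` has to be compared. At level zero both integer parts vanish.
    induction j with
    | zero =>
      simp only [pow_zero, one_mul]
      rw [Nat.floor_eq_zero.2, Nat.floor_eq_zero.2] <;> simp_all
    | succ j ih =>
      have hj := ih (h.trans_le (by linarith [hstep j, hdp j]))
      by_contra hne
      have hD : D x j ≠ D y j := fun hD => hne (by
        rw [← Nat.div_add_mod ⌊(q : ℝ) ^ (j + 1) * x⌋₊ q,
          ← Nat.div_add_mod ⌊(q : ℝ) ^ (j + 1) * y⌋₊ q, hdiv, hdiv, hj]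
        exact congrArg _ hD)
      have hgj : t j ≤ |g j| := by
        have h1 : (1 : ℝ) ≤ |(D x j : ℝ) - D y j| := by
          have h2 : ((D x j : ℤ) - D y j) ≠ 0 := sub_ne_zero.2 (by exact_mod_cast hD)
          exact_mod_cast Int.one_le_abs h2
        simp only [g]
        rw [← sub_mul, abs_mul, abs_of_pos (htp j)]
        exact le_mul_of_one_le_left (htp j).le h1
      have h1 : ∑' i, g i = g j + ∑' i, g (i + (j + 1)) := by
        rw [← hg.sum_add_tsum_nat_add (j + 1), Finset.sum_range_succ, Finset.sum_eq_zero
          fun i hi => hzero j hj i (Finset.mem_range.1 hi), zero_add]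
      have h2 : 2 * (d (j + 1) : ℝ) ≤ t j := by
        simp only [t]
        rw [le_div_iff₀ (by positivity)]
        linarith [hd' j]
      have h3 := htail (j + 1)
      have h4 := abs_sub_abs_le_abs_sub (g j) (-∑' i, g (i + (j + 1)))
      rw [sub_neg_eq_add, ← h1, abs_neg] at h4
      linarith [hdp (j + 1)]

/-! ### Scale gaps from doubling, and the two choices of scales. -/

/-- With `q = 2 ^ M`, the factor `2 ^ (M + 2)` is the `4 q` required by the coding in `ℝ`. If the
gap failed, `M + 2` doublings would give `φ (s n) ≤ L ^ (M + 2) * φ (s m)`, whereas comparability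
with `m ≥ 2 ^ (M - 2) * n` forces `a * 2 ^ (M - 2) ≤ L ^ (M + 2) * b`. -/
theorem IsDoublingWith.exists_mul_lt {φ : ℝ≥0 → ℝ≥0} {s : ℕ+ → ℝ≥0} (hφ : IsGauge φ)
    (hs : s ∈ nullSequences) {a b : ℝ≥0} (ha : 0 < a)
    (hab : ∀ n : ℕ+, a ≤ ((n : ℕ) : ℝ≥0) * φ (s n) ∧ ((n : ℕ) : ℝ≥0) * φ (s n) ≤ b)
    {L : ℝ≥0} (hL : L < 2) (h : IsDoublingWith L φ) :
    ∃ M : ℕ, 3 ≤ M ∧ ∃ K : ℕ+, ∀ n m : ℕ+, K ≤ n → 2 ^ (M - 2) * (n : ℕ) ≤ m →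
      2 ^ (M + 2) * s m ≤ s n := by
  obtain ⟨R, hR, hL2⟩ := h
  have hiter : ∀ (i : ℕ) (r : ℝ≥0), 0 < r → 2 ^ i * r ≤ R → φ (2 ^ i * r) ≤ L ^ i * φ r := by
    intro i
    induction i with
    | zero => intro r _ _; simp
    | succ i ih =>
      intro r hr hri
      have h1 : 2 ^ i * r ≤ 2 ^ (i + 1) * r := by
        gcongr
        · norm_num
        · omega
      calc φ (2 ^ (i + 1) * r) = φ (2 * (2 ^ i * r)) := by rw [pow_succ']; ring_nf
        _ ≤ L * φ (2 ^ i * r) := hL2 _ (by positivity) (h1.trans hri)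
        _ ≤ L * (L ^ i * φ r) := by gcongr; exact ih r hr (h1.trans hri)
        _ = L ^ (i + 1) * φ r := by ring
  have hb : 0 < b := ha.trans_le ((hab 1).1.trans (hab 1).2)
  have hlim : Tendsto (fun i : ℕ => (L / 2) ^ i) atTop (𝓝 0) :=
    NNReal.tendsto_pow_atTop_nhds_zero_of_lt_one ((div_lt_one (by norm_num)).2 hL)
  -- The `16` is the ratio of `2 ^ (M + 2)` to `2 ^ (M - 2)`. Such an `M` exists because `L / 2 <
  -- 1`.
  obtain ⟨M, hM, hM3⟩ := (((hlim.comp (tendsto_add_atTop_nat 2)).eventually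
    (gt_mem_nhds (show 0 < a / (16 * b) by positivity))).and (eventually_ge_atTop 3)).exists
  obtain ⟨K, hK⟩ := (hs.2.2.eventually
    (ge_mem_nhds (show 0 < R / 2 ^ (M + 2) by positivity))).exists
  refine ⟨M, hM3, K, fun n m hn hm => ?_⟩
  by_contra! hcon
  have hnm : n ≤ m := by
    rw [← PNat.coe_le_coe]
    exact (Nat.le_mul_of_pos_left _ (by positivity)).trans hm
  have hsm : 2 ^ (M + 2) * s m ≤ R := by
    have h1 := (hs.1.antitone (hn.trans hnm)).trans hK
    rwa [le_div_iff₀' (by positivity)] at h1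
  have h1 := (hφ.mono hcon.le).trans (hiter _ _ (hs.2.1 m) hsm)
  have h2 : a * 2 ^ (M - 2) ≤ L ^ (M + 2) * b := by
    have h3 : ((2 ^ (M - 2) * (n : ℕ) : ℕ) : ℝ≥0) ≤ ((m : ℕ) : ℝ≥0) := by exact_mod_cast hm
    push_cast at h3
    calc a * 2 ^ (M - 2) ≤ ((n : ℕ) * φ (s n)) * 2 ^ (M - 2) := by gcongr; exact (hab n).1
      _ = (2 ^ (M - 2) * (n : ℕ)) * φ (s n) := by ring
      _ ≤ ((m : ℕ) : ℝ≥0) * (L ^ (M + 2) * φ (s m)) := by gcongr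
      _ = L ^ (M + 2) * ((m : ℕ) * φ (s m)) := by ring
      _ ≤ _ := by gcongr; exact (hab m).2
  simp only [Function.comp_apply] at hM
  rw [div_pow, div_lt_div_iff₀ (by positivity) (by positivity)] at hM
  have h4 : (2 : ℝ≥0) ^ (M + 2) = 16 * 2 ^ (M - 2) := by
    obtain ⟨N, rfl⟩ := Nat.exists_eq_add_of_le hM3
    rw [show 3 + N - 2 = N + 1 by omega]
    ring
  rw [h4] at hM
  refine absurd h2 (not_le.2 ?_)
  have h5 : 16 * (L ^ (M + 2) * b) < 16 * (a * 2 ^ (M - 2)) := by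
    calc _ = L ^ (M + 2) * (16 * b) := by ring
      _ < _ := hM
      _ = _ := by ring
  exact lt_of_mul_lt_mul_left h5 zero_le

theorem lt_pnat_of_strictMono {n : ℕ → ℕ+} (hn : StrictMono n) (j : ℕ) : j < (n j : ℕ) := by
  induction j with
  | zero => exact (n 0).pos
  | succ j ih =>
    have h1 : (n j : ℕ) < n (j + 1) := hn (Nat.lt_succ_self j)
    omega

theorem tendsto_comp_of_mem_nullSequences {s : ℕ+ → ℝ≥0} (hs : s ∈ nullSequences) {n : ℕ → ℕ+}
    (hn : StrictMono n) : Tendsto (fun j => s (n j)) atTop (𝓝 0) :=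
  hs.2.2.comp (tendsto_atTop_atTop.2 fun m => ⟨m, fun j hj => by
    rw [← PNat.coe_le_coe]
    exact hj.trans (lt_pnat_of_strictMono hn j).le⟩)

theorem strictMono_of_two_pow_mul_le {M : ℕ} (hM : 3 ≤ M) {n : ℕ → ℕ+}
    (h : ∀ j, 2 ^ (M - 2) * (n j : ℕ) ≤ n (j + 1)) :
    StrictMono n ∧ ∀ j, 2 ^ j ≤ (n j : ℕ) := by
  have h2 : ∀ j, 2 * (n j : ℕ) ≤ n (j + 1) := fun j => by
    refine le_trans (Nat.mul_le_mul_right _ ?_) (h j)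
    exact le_self_pow₀ one_le_two (by omega)
  constructor
  · refine strictMono_nat_of_lt_succ fun j => ?_
    rw [← PNat.coe_lt_coe]
    have := h2 j
    have := (n j).pos
    omega
  · intro j
    induction j with
    | zero => exact (n 0).pos
    | succ j ih =>
      have := h2 j
      rw [pow_succ]
      omega

section Strict

variable {X : Type*} [MetricSpace X] {φ : ℝ≥0 → ℝ≥0} {s : ℕ+ → ℝ≥0} {a b : ℝ≥0} {M : ℕ} {K : ℕ+}

/-- The scales `n j = K * q ^ j` with `q = 2 ^ M` make `q ^ j * φ (s (n j))` at least `a / K`. The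
hypothesis `hcode` isolates what is needed from the space `X`. -/
theorem exists_dominated_notMem_nullSets (hφ : IsGauge φ) (hs : s ∈ nullSequences) (ha : 0 < a)
    (has : ∀ n : ℕ+, a ≤ ((n : ℕ) : ℝ≥0) * φ (s n)) (hM : 3 ≤ M)
    (hcode : ∀ n : ℕ → ℕ+, K ≤ n 0 → (∀ j, 2 ^ (M - 2) * (n j : ℕ) ≤ n (j + 1)) →
      ∃ f : ℝ → X, IsAdicCoding (2 ^ M) (fun j => s (n j)) f) :
    ∃ E ∈ dominatedSets X (multClosure s), E ∉ nullSets X φ := by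
  let n : ℕ → ℕ+ := fun j => K * 2 ^ (M * j)
  have hnc : ∀ j, (n j : ℕ) = K * 2 ^ (M * j) := fun j => by simp [n]
  have hstep : ∀ j, 2 ^ (M - 2) * (n j : ℕ) ≤ n (j + 1) := fun j => by
    rw [hnc, hnc, mul_left_comm, ← pow_add]
    gcongr
    · norm_num
    · rw [mul_add]; omega
  obtain ⟨f, hf⟩ := hcode n (by simp [n]) hstep
  have hn := (strictMono_of_two_pow_mul_le hM hstep).1
  have hq : 2 ≤ 2 ^ M := le_self_pow₀ one_le_two (by omega)
  refine ⟨f '' Ico 0 1, hf.image_mem_dominatedSets hs.1 (K := K) hq fun j m hm => ?_,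
    hf.image_notMem_nullSets hφ hq (hs.1.comp_strictMono hn) (fun j => hs.2.1 _)
      (tendsto_comp_of_mem_nullSequences hs hn) (c := a / (K : ℕ)) (fun j => ?_)
      (div_pos ha (by exact_mod_cast K.pos))⟩
  · refine hs.1 ?_
    rw [← PNat.coe_lt_coe, hnc, pow_mul]
    exact hm
  · rw [div_le_iff₀' (by exact_mod_cast K.pos)]
    refine (has (n j)).trans_eq ?_
    rw [hnc]
    push_cast
    rw [pow_mul, mul_assoc]

theorem exists_null_notMem_dominatedSets (hφ : IsGauge φ) (hs : s ∈ nullSequences)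
    (hbs : ∀ n : ℕ+, ((n : ℕ) : ℝ≥0) * φ (s n) ≤ b) (hM : 3 ≤ M)
    (hcode : ∀ n : ℕ → ℕ+, K ≤ n 0 → (∀ j, 2 ^ (M - 2) * (n j : ℕ) ≤ n (j + 1)) →
      ∃ f : ℝ → X, IsAdicCoding (2 ^ M) (fun j => s (n j)) f) :
    ∃ E, (∀ α : ℝ, 1 < α → E ∈ nullSets X (gaugePow φ α)) ∧
      E ∉ dominatedSets X (multClosure s) := by
  -- The number `4 ^ l j` stands for `(j + 1) ^ 2` up to a factor `4`, so `n j` is about `K * q ^ j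
  -- / (j + 1) ^ 2` and still an integer. As `l` grows by at most one per step, consecutive scales
  -- keep the ratio `2 ^ (M - 2)`.
  let l : ℕ → ℕ := fun j => Nat.log 2 (j + 1)
  let n : ℕ → ℕ+ := fun j => K * 2 ^ (M * j - 2 * l j)
  have hnc : ∀ j, (n j : ℕ) = K * 2 ^ (M * j - 2 * l j) := fun j => by simp [n]
  have hl : ∀ j, l j ≤ j := fun j => Nat.lt_succ_iff.1 (Nat.log_lt_self 2 j.succ_ne_zero)
  have hlM : ∀ j, 2 * l j ≤ M * j := fun j => Nat.mul_le_mul (by omega) (hl j)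
  have hl1 : ∀ j, l (j + 1) ≤ l j + 1 := fun j => by
    have h1 : l j + 1 = Nat.log 2 ((j + 1) * 2) :=
      (Nat.log_mul_base one_lt_two j.succ_ne_zero).symm
    rw [h1]
    exact Nat.log_mono_right (by omega)
  have hl2 : ∀ j, 4 ^ l j ≤ (j + 1) ^ 2 := fun j => by
    have h1 : 2 ^ l j ≤ j + 1 := Nat.pow_log_le_self 2 j.succ_ne_zero
    calc 4 ^ l j = (2 ^ l j) ^ 2 := by rw [← pow_mul, mul_comm, pow_mul]; norm_num
      _ ≤ _ := Nat.pow_le_pow_left h1 2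
  have hl3 : ∀ j, (j + 1) ^ 2 ≤ 4 * 4 ^ l j := fun j => by
    have h1 : j + 1 < 2 ^ (l j + 1) := Nat.lt_pow_succ_log_self one_lt_two _
    calc (j + 1) ^ 2 ≤ (2 ^ (l j + 1)) ^ 2 := Nat.pow_le_pow_left h1.le 2
      _ = 4 * 4 ^ l j := by rw [← pow_succ', ← pow_mul, mul_comm, pow_mul]; norm_num
  have hn4 : ∀ j, (n j : ℕ) * 4 ^ l j = K * (2 ^ M) ^ j := fun j => by
    rw [hnc, mul_assoc, show (4 : ℕ) = 2 ^ 2 by norm_num, ← pow_mul, ← pow_add,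
      Nat.sub_add_cancel (hlM j), pow_mul]
  have hstep : ∀ j, 2 ^ (M - 2) * (n j : ℕ) ≤ n (j + 1) := fun j => by
    rw [hnc, hnc, mul_left_comm, ← pow_add]
    gcongr
    · norm_num
    · have := hl1 j
      have := hlM j
      rw [mul_add]
      omega
  obtain ⟨f, hf⟩ := hcode n (by simp [n, l]) hstep
  obtain ⟨hn, hn2⟩ := strictMono_of_two_pow_mul_le hM hstep
  have hq : 2 ≤ 2 ^ M := le_self_pow₀ one_le_two (by omega)
  refine ⟨f '' Ico 0 1, fun α hα => hf.image_mem_nullSets (hφ.gaugePow (one_pos.trans hα))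
    (by positivity) (tendsto_comp_of_mem_nullSequences hs hn) ?_,
    hf.image_notMem_dominatedSets hs.1 hq hn ?_⟩
  · have hβ : 0 < α - 1 := sub_pos.2 hα
    -- From `n j ≥ 2 ^ j`, the extra factor `φ (s (n j)) ^ (α - 1)` is at most `b ^ (α - 1) * ρ ^
    -- j`, and this geometric decay absorbs the loss `(j + 1) ^ 2`.
    set ρ : ℝ≥0 := (1 / 2) ^ (α - 1) with hρ
    have hρ0 : 0 < ρ := NNReal.rpow_pos (by positivity)
    have hρ1 : ρ < 1 := NNReal.rpow_lt_one (by norm_num) hβ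
    have hlim : Tendsto (fun j : ℕ => b * b ^ (α - 1) * ρ⁻¹ * (((j + 1 : ℕ) : ℝ≥0) ^ 2 * ρ ^ (j + 1)))
        atTop (𝓝 0) := by
      have h1 : Tendsto (fun j : ℕ => (j : ℝ≥0) ^ 2 * ρ ^ j) atTop (𝓝 0) := by
        rw [← NNReal.tendsto_coe]
        push_cast
        exact tendsto_pow_const_mul_const_pow_of_lt_one 2 ρ.2 (by exact_mod_cast hρ1)
      simpa using (h1.comp (tendsto_add_atTop_nat 1)).const_mul (b * b ^ (α - 1) * ρ⁻¹)
    refine tendsto_of_tendsto_of_tendsto_of_le_of_le tendsto_const_nhds hlim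
      (fun _ => zero_le) fun j => ?_
    have hnj : (0 : ℝ≥0) < (n j : ℕ) := by exact_mod_cast (n j).pos
    have h1 : ((2 ^ M : ℕ) : ℝ≥0) ^ j ≤ (n j : ℕ) * ((j + 1 : ℕ) : ℝ≥0) ^ 2 := by
      have : (2 ^ M) ^ j ≤ (n j : ℕ) * (j + 1) ^ 2 := by
        calc (2 ^ M) ^ j ≤ (K : ℕ) * (2 ^ M) ^ j := Nat.le_mul_of_pos_left _ K.pos
          _ = (n j : ℕ) * 4 ^ l j := (hn4 j).symm
          _ ≤ _ := Nat.mul_le_mul_left _ (hl2 j)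
      exact_mod_cast this
    have h2 : φ (s (n j)) ^ (α - 1) ≤ b ^ (α - 1) * ρ ^ j := by
      have h3 : φ (s (n j)) ≤ b * (1 / 2) ^ j := by
        have h4 : ((2 ^ j : ℕ) : ℝ≥0) ≤ (n j : ℕ) := by exact_mod_cast hn2 j
        push_cast at h4
        rw [one_div, inv_pow, ← div_eq_mul_inv, le_div_iff₀' (by positivity)]
        exact (mul_le_mul_left h4 _).trans (hbs _)
      refine (NNReal.rpow_le_rpow h3 hβ.le).trans_eq ?_
      rw [NNReal.mul_rpow, hρ, ← NNReal.rpow_natCast, ← NNReal.rpow_natCast, ← NNReal.rpow_mul,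
        ← NNReal.rpow_mul, mul_comm (j : ℝ)]
    have h3 : gaugePow φ α (s (n j)) = φ (s (n j)) * φ (s (n j)) ^ (α - 1) := by
      have h4 : φ (s (n j)) ≠ 0 := (hφ.pos _ (hs.2.1 _)).ne'
      rw [gaugePow, NNReal.rpow_sub_one h4, mul_div_cancel₀ _ h4]
    calc ((2 ^ M : ℕ) : ℝ≥0) ^ j * gaugePow φ α (s (n j))
        ≤ ((n j : ℕ) * ((j + 1 : ℕ) : ℝ≥0) ^ 2) * (φ (s (n j)) * (b ^ (α - 1) * ρ ^ j)) := by
          rw [h3]; gcongr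
      _ = ((n j : ℕ) * φ (s (n j))) * b ^ (α - 1) * (((j + 1 : ℕ) : ℝ≥0) ^ 2 * ρ ^ j) := by ring
      _ ≤ b * b ^ (α - 1) * (((j + 1 : ℕ) : ℝ≥0) ^ 2 * ρ ^ j) := by gcongr; exact hbs _
      _ = _ := by rw [pow_succ ρ]; field_simp
  · have hS : Summable fun j : ℕ => 4 * (K : ℕ) * 2 ^ M * (((j + 2 : ℕ) : ℝ≥0) ^ 2)⁻¹ := by
      refine Summable.mul_left _ ((NNReal.summable_nat_add_iff
        (f := fun j : ℕ => ((j : ℝ≥0) ^ 2)⁻¹) 2).2 ?_)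
      simpa using NNReal.summable_rpow_inv.2 one_lt_two
    refine ne_top_of_le_ne_top (ENNReal.tsum_coe_ne_top_iff_summable.2 hS)
      (ENNReal.tsum_le_tsum fun j => ?_)
    have h1 : (n (j + 1) : ℕ) * (j + 2) ^ 2 ≤ 4 * K * 2 ^ M * (2 ^ M) ^ j := by
      calc (n (j + 1) : ℕ) * (j + 2) ^ 2 ≤ n (j + 1) * (4 * 4 ^ l (j + 1)) :=
            Nat.mul_le_mul_left _ (hl3 (j + 1))
        _ = 4 * (n (j + 1) * 4 ^ l (j + 1)) := by ring
        _ = _ := by rw [hn4]; ring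
    have h2 : ((n (j + 1) : ℕ) : ℝ≥0) * ((j + 2 : ℕ) : ℝ≥0) ^ 2 ≤
        4 * (K : ℕ) * 2 ^ M * ((2 ^ M : ℕ) : ℝ≥0) ^ j := by exact_mod_cast h1
    have hq0 : ((2 ^ M : ℕ) : ℝ≥0) ^ j ≠ 0 := by positivity
    have h3 : (((2 ^ M : ℕ) : ℝ≥0) ^ j)⁻¹ * (n (j + 1) : ℕ) ≤
        4 * (K : ℕ) * 2 ^ M * (((j + 2 : ℕ) : ℝ≥0) ^ 2)⁻¹ := by
      rw [← div_eq_mul_inv, inv_mul_eq_div, div_le_div_iff₀ (by positivity) (by positivity)]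
      exact h2
    have h4 := ENNReal.coe_le_coe.2 h3
    rwa [ENNReal.coe_mul, ENNReal.coe_inv hq0, ENNReal.coe_pow, ENNReal.coe_natCast,
      ENNReal.coe_natCast] at h4

theorem nullSets_ssubset_dominatedSets_ssubset (hφ : IsGauge φ) (hs : s ∈ nullSequences)
    (ha : 0 < a)
    (hab : ∀ n : ℕ+, a ≤ ((n : ℕ) : ℝ≥0) * φ (s n) ∧ ((n : ℕ) : ℝ≥0) * φ (s n) ≤ b) (hM : 3 ≤ M)
    (hcode : ∀ n : ℕ → ℕ+, K ≤ n 0 → (∀ j, 2 ^ (M - 2) * (n j : ℕ) ≤ n (j + 1)) →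
      ∃ f : ℝ → X, IsAdicCoding (2 ^ M) (fun j => s (n j)) f) :
    nullSets X φ ⊂ dominatedSets X (multClosure s) ∧
      dominatedSets X (multClosure s) ⊂ ⋂ (α : ℝ) (_ : 1 < α), nullSets X (gaugePow φ α) := by
  obtain ⟨E, hE, hE'⟩ := exists_dominated_notMem_nullSets hφ hs ha (fun n => (hab n).1) hM hcode
  obtain ⟨F, hF, hF'⟩ := exists_null_notMem_dominatedSets hφ hs (fun n => (hab n).2) hM hcode
  exact ⟨⟨nullSets_subset_dominatedSets hφ ha (fun n => (hab n).1) hs, fun h => hE' (h hE)⟩,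
    subset_iInter₂ fun α hα => dominatedSets_subset_nullSets hφ (fun n => (hab n).2) hs hα,
    fun h => hF' (h (mem_iInter₂.2 hF))⟩

end Strict

end DominatedSets

theorem theorem5p7 (s : ℕ+ → ℝ≥0) (hs : s ∈ DominatedSets.nullSequences)
    (φ : ℝ≥0 → ℝ≥0) (hφ : DominatedSets.IsGauge φ) (hφs : DominatedSets.Comparable φ s) :
    (DominatedSets.nullSets DominatedSets.EllTwo φ ⊂
        DominatedSets.dominatedSets DominatedSets.EllTwo (DominatedSets.multClosure s) ∧
      DominatedSets.dominatedSets DominatedSets.EllTwo (DominatedSets.multClosure s) ⊂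
        ⋂ (α : ℝ) (_ : 1 < α),
          DominatedSets.nullSets DominatedSets.EllTwo (DominatedSets.gaugePow φ α)) ∧
    (∀ L : ℝ≥0, 0 < L → L < 2 → DominatedSets.IsDoublingWith L φ →
      DominatedSets.nullSets ℝ φ ⊂
        DominatedSets.dominatedSets ℝ (DominatedSets.multClosure s) ∧
      DominatedSets.dominatedSets ℝ (DominatedSets.multClosure s) ⊂
        ⋂ (α : ℝ) (_ : 1 < α),
          DominatedSets.nullSets ℝ (DominatedSets.gaugePow φ α)) := by
  obtain ⟨a, b, ha, -, hab⟩ := hφs.exists_forall hφ hs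
  refine ⟨?_, fun L _ hL hdoub => ?_⟩
  -- The coding in `ℓ²` needs no scale gap, only strictly increasing indices, so `M = 3` and `K = 1`
  -- suffice.
  · refine DominatedSets.nullSets_ssubset_dominatedSets_ssubset hφ hs ha hab le_rfl (K := 1)
      fun n _ hn => ?_
    have hmono := (DominatedSets.strictMono_of_two_pow_mul_le le_rfl hn).1
    exact DominatedSets.exists_isAdicCoding_ellTwo (by norm_num) (hs.1.comp_strictMono hmono)
      (DominatedSets.tendsto_comp_of_mem_nullSequences hs hmono)
  · obtain ⟨M, hM, K, hK⟩ := hdoub.exists_mul_lt hφ hs ha hab hL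
    refine DominatedSets.nullSets_ssubset_dominatedSets_ssubset hφ hs ha hab hM (K := K)
      fun n hn0 hn => ?_
    have hmono := (DominatedSets.strictMono_of_two_pow_mul_le hM hn).1
    refine DominatedSets.exists_isAdicCoding_real (le_self_pow₀ one_le_two (by omega))
      (fun j => hs.2.1 _) fun j => ?_
    refine le_trans (le_of_eq ?_) (hK _ _ (hn0.trans (hmono.monotone (Nat.zero_le j))) (hn j))
    push_cast
    ring
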